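/- Let $A$ be a pro-$C^*$-algebra, i.e. a complete Hausdorff complex topological $*$-algebra (not necessarily unital) whose topology is determined by the directed set $S(A)$ of all its continuous $C^*$-seminorms. Let $E$ be a (right) Hilbert $A$-module, complete for the topology given by the seminorms $\bar p_E(\xi)=p(\langle\xi,\xi\rangle)^{1/2}$, $p\in S(A)$. Let $M(E)=L(A,E)$ be its multiplier module, i.e. the right module over $M(A)=L(A)$ of all adjointable module morphisms $h:A\to E$, with the topology given by the seminorms $\tilde p(h)=\sup\{\bar p_E(h(a)) : a\in A,\ p(a)\le 1\}$, $p\in S(A)$. Here $E$ is identified with a submodule of $M(E)$ by $\xi\mapsto(a\mapsto \xi a)$; accordingly, for $h\in M(E)$, $a\in A$ and $\xi\in E$, we write $h\cdot a=h(a)\in E$, $\langle h,\xi\rangle=h^*(\xi)\in A$ and $\langle\xi,h\rangle=\langle h,\xi\rangle^*$. Suppose that $E$ is countably generated in $M(E)$, i.e. there is a countable set $\{g_n\}_n\subseteq M(E)$ such that the closed submodule of $M(E)$ generated by $\{g_n\cdot a : a\in A,\ n=1,2,\dots\}$ is $E$, and let $\{h_n\}_n$ be a sequence in $M(E)$. Then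 $\{h_n\}_n$ is a standard normalised frame of multipliers in $E$, i.e. for every $\xi\in E$ the series $\sum_n\langle\xi,h_n\rangle\langle h_n,\xi\rangle$ converges in $A$ and $$\sum_n\langle\xi,h_n\rangle\langle h_n,\xi\rangle=\langle\xi,\xi\rangle ,$$ if and only if for every $\xi\in E$ the series $\sum_n h_n\cdot\langle h_n,\xi\rangle$ converges in $E$ and $$\xi=\sum_n h_n\cdot\langle h_n,\xi\rangle .$$ -/

import Mathlib

open Filter Topology
open scoped ENNReal RightActions

/-- `S(A)`: the set of all continuous C⋆-seminorms on a topological complex `*`-algebra `A`. -/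
def contCStarSeminorms (A : Type*) [NonUnitalRing A] [StarRing A] [Module ℂ A]
    [TopologicalSpace A] : Set (Seminorm ℂ A) :=
  {p | Continuous p ∧ (∀ a b : A, p (a * b) ≤ p a * p b) ∧ ∀ a : A, p (star a * a) = p a ^ 2}

/-- A (not necessarily unital) pro-C⋆-algebra: a complete Hausdorff complex topological
`*`-algebra whose topology is determined by its continuous C⋆-seminorms. These form a directed
set, hence the sets `{a | p a < ε}` are a basis of neighbourhoods of `0`. -/
class ProCStarAlgebra (A : Type*) [NonUnitalRing A] [StarRing A] [Module ℂ A]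
    [IsScalarTower ℂ A A] [SMulCommClass ℂ A A] [StarModule ℂ A]
    [UniformSpace A] [IsUniformAddGroup A] : Prop where
  t2 : T2Space A
  complete : CompleteSpace A
  mem_nhds_zero_iff : ∀ U : Set A,
    U ∈ 𝓝 (0 : A) ↔ ∃ p ∈ contCStarSeminorms A, ∃ ε : ℝ, 0 < ε ∧ {a : A | p a < ε} ⊆ U

theorem ProCStarAlgebra.star_mul_self_eq_zero {A : Type*} [NonUnitalRing A] [StarRing A]
    [Module ℂ A] [IsScalarTower ℂ A A] [SMulCommClass ℂ A A] [StarModule ℂ A]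
    [UniformSpace A] [IsUniformAddGroup A] [ProCStarAlgebra A] (a : A) :
    star a * a = 0 ↔ a = 0 := by
  refine ⟨fun h => ?_, fun h => by simp [h]⟩
  have := ProCStarAlgebra.t2 (A := A)
  by_contra ha
  have hU : ({a}ᶜ : Set A) ∈ 𝓝 (0 : A) :=
    isOpen_compl_singleton.mem_nhds (by simpa using Ne.symm ha)
  obtain ⟨p, hp, ε, hε, hs⟩ := (ProCStarAlgebra.mem_nhds_zero_iff _).1 hU
  have h0 : p a = 0 := by
    have h2 := hp.2.2 a
    rw [h, map_zero] at h2
    exact pow_eq_zero_iff two_ne_zero |>.1 h2.symm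
  exact hs (show p a < ε by rw [h0]; exact hε) rfl

/-- A pre-Hilbert `A`-module: a complex vector space `E` which is also a right `A`-module,
compatibly with the complex algebra structure, with an `A`-valued inner product which is
`ℂ`- and `A`-linear in its second variable. The right action of `a` on `x` is `x <• a`. -/
class PreHilbertModule (A E : Type*) [NonUnitalRing A] [StarRing A] [Module ℂ A]
    [PartialOrder A] [AddCommGroup E] [Module ℂ E] [SMul Aᵐᵒᵖ E] extends Inner A E where
  add_rsmul : ∀ (x y : E) (a : A), (x + y) <• a = x <• a + y <• a
  rsmul_add : ∀ (x : E) (a b : A), x <• (a + b) = x <• a + x <• b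
  rsmul_mul : ∀ (x : E) (a b : A), x <• (a * b) = (x <• a) <• b
  smul_rsmul : ∀ (c : ℂ) (x : E) (a : A), (c • x) <• a = c • (x <• a)
  rsmul_smul : ∀ (c : ℂ) (x : E) (a : A), x <• (c • a) = c • (x <• a)
  inner_add_right : ∀ x y z : E, inner x (y + z) = inner x y + inner x z
  inner_smul_right : ∀ (c : ℂ) (x y : E), inner x (c • y) = c • inner x y
  inner_rsmul_right : ∀ (x y : E) (a : A), inner x (y <• a) = inner x y * a
  star_inner : ∀ x y : E, star (inner x y) = inner y x
  inner_self_nonneg : ∀ x : E, 0 ≤ inner x x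
  inner_self_eq_zero : ∀ x : E, inner x x = 0 ↔ x = 0

section Modules

variable {A : Type*} [NonUnitalRing A] [StarRing A] [Module ℂ A] [PartialOrder A]
variable {E : Type*} [AddCommGroup E] [Module ℂ E] [SMul Aᵐᵒᵖ E] [PreHilbertModule A E]
variable {F : Type*} [AddCommGroup F] [Module ℂ F] [SMul Aᵐᵒᵖ F] [PreHilbertModule A F]
variable {G : Type*} [AddCommGroup G] [Module ℂ G] [SMul Aᵐᵒᵖ G] [PreHilbertModule A G]

/-- The seminorm `x ↦ p(⟨x, x⟩)^(1/2)` on a pre-Hilbert `A`-module attached to a seminorm `p`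
on `A`. -/
noncomputable def moduleSeminorm (p : Seminorm ℂ A) (x : E) : ℝ := √(p (inner A x x))

variable (A E) in
/-- A Hilbert `A`-module: a pre-Hilbert module which is complete with respect to the topology
determined by the (directed) family of seminorms `moduleSeminorm p`, `p ∈ S(A)`. -/
class HilbertModule [TopologicalSpace A] [UniformSpace E] [IsUniformAddGroup E] : Prop where
  complete : CompleteSpace E
  mem_nhds_zero_iff : ∀ U : Set E,
    U ∈ 𝓝 (0 : E) ↔ ∃ p ∈ contCStarSeminorms A, ∃ ε : ℝ, 0 < ε ∧
      {x : E | moduleSeminorm p x < ε} ⊆ U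

variable (A E F) in
/-- `L(E, F)`: the adjointable module morphisms from `E` to `F`. The adjoint is part of the data;
it is unique, see `AdjointableMap.ext`. -/
structure AdjointableMap where
  toLin : E →ₗ[ℂ] F
  map_rsmul : ∀ (x : E) (a : A), toLin (x <• a) = toLin x <• a
  adj : F →ₗ[ℂ] E
  adj_rsmul : ∀ (y : F) (a : A), adj (y <• a) = adj y <• a
  inner_map_left : ∀ (x : E) (y : F), inner A (toLin x) y = inner A x (adj y)

namespace PreHilbertModule

theorem inner_sub_right' (x y z : E) : inner A x (y - z) = inner A x y - inner A x z := by
  rw [eq_sub_iff_add_eq, ← inner_add_right, sub_add_cancel]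

theorem inner_add_left (x y z : E) : inner A (x + y) z = inner A x z + inner A y z := by
  rw [← star_inner z, inner_add_right, star_add, star_inner, star_inner]

theorem inner_zero_right (x : E) : inner A x (0 : E) = 0 := by
  simpa using inner_sub_right' (A := A) x 0 0

theorem inner_zero_left (x : E) : inner A (0 : E) x = 0 := by
  rw [← star_inner x, inner_zero_right, star_zero]

theorem inner_neg_right (x y : E) : inner A x (-y) = -inner A x y := by
  simpa [inner_zero_right] using inner_sub_right' (A := A) x 0 y

theorem inner_neg_left (x y : E) : inner A (-x) y = -inner A x y := by
  rw [← star_inner y, inner_neg_right, star_neg, star_inner]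

theorem ext_inner {x y : E} (h : ∀ z : E, inner A z x = inner A z y) : x = y := by
  rw [← sub_eq_zero, ← inner_self_eq_zero (A := A), inner_sub_right', h, sub_self]

variable (A) in
theorem zero_rsmul (a : A) : (0 : E) <• a = 0 := by
  simpa using smul_rsmul (0 : ℂ) (0 : E) a

theorem neg_rsmul (x : E) (a : A) : (-x) <• a = -(x <• a) := by
  simpa using smul_rsmul (-1 : ℂ) x a

end PreHilbertModule

namespace AdjointableMap

instance : CoeFun (AdjointableMap A E F) fun _ => E → F := ⟨fun T => T.toLin⟩

/-- An adjointable map is determined by its underlying function. -/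
theorem ext {T S : AdjointableMap A E F} (h : ∀ x, T x = S x) : T = S := by
  have h1 : T.toLin = S.toLin := LinearMap.ext h
  have h2 : T.adj = S.adj := LinearMap.ext fun y => PreHilbertModule.ext_inner (A := A) fun z => by
    rw [← T.inner_map_left, ← S.inner_map_left, h1]
  cases T; cases S; cases h1; cases h2; rfl

instance : Zero (AdjointableMap A E F) where
  zero :=
    { toLin := 0
      map_rsmul := fun x a => by simp [PreHilbertModule.zero_rsmul]
      adj := 0
      adj_rsmul := fun x a => by simp [PreHilbertModule.zero_rsmul]
      inner_map_left := fun x y => by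
        simp [PreHilbertModule.inner_zero_left, PreHilbertModule.inner_zero_right] }

instance : Add (AdjointableMap A E F) where
  add T S :=
    { toLin := T.toLin + S.toLin
      map_rsmul := fun x a => by simp [PreHilbertModule.add_rsmul, map_rsmul]
      adj := T.adj + S.adj
      adj_rsmul := fun x a => by simp [PreHilbertModule.add_rsmul, adj_rsmul]
      inner_map_left := fun x y => by
        simp [PreHilbertModule.inner_add_left, PreHilbertModule.inner_add_right, inner_map_left] }

instance : Neg (AdjointableMap A E F) where
  neg T :=
    { toLin := -T.toLin
      map_rsmul := fun x a => by simp [PreHilbertModule.neg_rsmul, map_rsmul]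
      adj := -T.adj
      adj_rsmul := fun x a => by simp [PreHilbertModule.neg_rsmul, adj_rsmul]
      inner_map_left := fun x y => by
        simp [PreHilbertModule.inner_neg_left, PreHilbertModule.inner_neg_right, inner_map_left] }

theorem zero_apply (x : E) : (0 : AdjointableMap A E F) x = 0 := rfl
theorem add_apply (T S : AdjointableMap A E F) (x : E) : (T + S) x = T x + S x := rfl
theorem neg_apply (T : AdjointableMap A E F) (x : E) : (-T) x = -T x := rfl

instance : AddCommGroup (AdjointableMap A E F) where
  add_assoc T S R := ext fun x => by simp only [add_apply, add_assoc]
  zero_add T := ext fun x => by simp only [add_apply, zero_apply, zero_add]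
  add_zero T := ext fun x => by simp only [add_apply, zero_apply, add_zero]
  neg_add_cancel T := ext fun x => by
    simp only [add_apply, neg_apply, zero_apply, neg_add_cancel]
  add_comm T S := ext fun x => by simp only [add_apply, add_comm]
  nsmul := nsmulRec
  zsmul := zsmulRec

/-- Composition of adjointable maps. -/
def comp (T : AdjointableMap A F G) (S : AdjointableMap A E F) : AdjointableMap A E G where
  toLin := T.toLin ∘ₗ S.toLin
  map_rsmul := fun x a => by simp [map_rsmul]
  adj := S.adj ∘ₗ T.adj
  adj_rsmul := fun x a => by simp [adj_rsmul]
  inner_map_left := fun x y => by simp [inner_map_left]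

/-- The adjoint `T⋆ : F → E` of `T : E → F`, as an adjointable map. -/
def adjoint (T : AdjointableMap A E F) : AdjointableMap A F E where
  toLin := T.adj
  map_rsmul := T.adj_rsmul
  adj := T.toLin
  adj_rsmul := T.map_rsmul
  inner_map_left := fun y x => by
    rw [← PreHilbertModule.star_inner x, ← T.inner_map_left, PreHilbertModule.star_inner]

instance : One (AdjointableMap A E E) where
  one :=
    { toLin := LinearMap.id
      map_rsmul := fun _ _ => rfl
      adj := LinearMap.id
      adj_rsmul := fun _ _ => rfl
      inner_map_left := fun _ _ => rfl }

instance : Mul (AdjointableMap A E E) := ⟨comp⟩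

theorem comp_apply (T : AdjointableMap A F G) (S : AdjointableMap A E F) (x : E) :
    T.comp S x = T (S x) := rfl
theorem one_apply (x : E) : (1 : AdjointableMap A E E) x = x := rfl
theorem mul_apply (T S : AdjointableMap A E E) (x : E) : (T * S) x = T (S x) := rfl

/-- `L(E) = L(E, E)` is a ring under composition. -/
instance : Ring (AdjointableMap A E E) :=
  { (inferInstance : AddCommGroup (AdjointableMap A E E)) with
    left_distrib := fun T S R => ext fun x => by simp only [add_apply, mul_apply, map_add]
    right_distrib := fun T S R => ext fun x => by simp only [add_apply, mul_apply]
    zero_mul := fun T => ext fun x => by simp only [zero_apply, mul_apply]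
    mul_zero := fun T => ext fun x => by simp only [zero_apply, mul_apply, map_zero]
    mul_assoc := fun T S R => ext fun x => by simp only [mul_apply]
    one_mul := fun T => ext fun x => by simp only [mul_apply, one_apply]
    mul_one := fun T => ext fun x => by simp only [mul_apply, one_apply] }

/-- `L(E, F)` is a right `L(E)`-module with `T · S = T ∘ S`. -/
instance : Module (AdjointableMap A E E)ᵐᵒᵖ (AdjointableMap A E F) where
  smul S T := T.comp S.unop
  one_smul _ := rfl
  mul_smul _ _ _ := rfl
  smul_zero _ := ext fun _ => rfl
  smul_add _ _ _ := ext fun _ => rfl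
  add_smul S R T := ext fun x => T.toLin.map_add (S.unop x) (R.unop x)
  zero_smul T := ext fun _ => T.toLin.map_zero

/-- The seminorm on `L(E, F)` attached to `p ∈ S(A)`: the operator norm of the map induced by `T`
between the quotients of `E` and `F` by the kernels of `moduleSeminorm p`. It is finite for every
adjointable map; taking values in `[0, ∞]` makes the supremum meaningful without that fact. -/
noncomputable def opSeminorm (p : Seminorm ℂ A) (T : AdjointableMap A E F) : ℝ≥0∞ :=
  ⨆ (x : E) (_ : moduleSeminorm p x ≤ 1), ENNReal.ofReal (moduleSeminorm p (T x))

/-- The locally convex topology on `L(E, F)` determined by the seminorms `opSeminorm p`,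
`p ∈ S(A)`. -/
instance [TopologicalSpace A] : TopologicalSpace (AdjointableMap A E F) :=
  TopologicalSpace.generateFrom
    {U | ∃ p ∈ contCStarSeminorms A, ∃ (T : AdjointableMap A E F) (ε : ℝ≥0∞), 0 < ε ∧
      U = {S | opSeminorm p (S - T) < ε}}

end AdjointableMap

end Modules

section Multipliers

variable {A : Type*} [NonUnitalRing A] [StarRing A] [Module ℂ A]
  [IsScalarTower ℂ A A] [SMulCommClass ℂ A A] [StarModule ℂ A]
  [PartialOrder A] [StarOrderedRing A] [UniformSpace A] [IsUniformAddGroup A] [ProCStarAlgebra A]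
variable {E : Type*} [AddCommGroup E] [Module ℂ E] [SMul Aᵐᵒᵖ E] [PreHilbertModule A E]

/-- A pro-C⋆-algebra as a module over itself, with `⟨a, b⟩ = a⋆ b`. -/
instance ProCStarAlgebra.instPreHilbertModule : PreHilbertModule A A where
  inner a b := star a * b
  add_rsmul x y a := add_mul x y a
  rsmul_add x a b := mul_add x a b
  rsmul_mul x a b := (mul_assoc x a b).symm
  smul_rsmul c x a := smul_mul_assoc c x a
  rsmul_smul c x a := mul_smul_comm c x a
  inner_add_right x y z := mul_add _ y z
  inner_smul_right c x y := mul_smul_comm c _ y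
  inner_rsmul_right x y a := (mul_assoc (star x) y a).symm
  star_inner x y := by simp
  inner_self_nonneg x := star_mul_self_nonneg x
  inner_self_eq_zero x := ProCStarAlgebra.star_mul_self_eq_zero x

variable (A) in
/-- The multiplier algebra `M(A) = L(A)`. -/
abbrev MultiplierAlgebra := AdjointableMap A A A

variable (A E) in
/-- The multiplier module `M(E) = L(A, E)`, a right module over `M(A)`. -/
abbrev MultiplierModule := AdjointableMap A A E

namespace MultiplierModule

open PreHilbertModule

variable (A) in
/-- The embedding `i_E : E → M(E)`, `i_E(ξ)(a) = ξ a`. For `E = A` this is the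
embedding of `A` in `M(A)` by left multiplications. -/
def ofModule (ξ : E) : MultiplierModule A E where
  toLin :=
    { toFun := fun a => ξ <• a
      map_add' := rsmul_add ξ
      map_smul' := fun c a => rsmul_smul c ξ a }
  map_rsmul := fun a b => rsmul_mul ξ a b
  adj :=
    { toFun := fun η => inner A ξ η
      map_add' := PreHilbertModule.inner_add_right ξ
      map_smul' := fun c η => PreHilbertModule.inner_smul_right c ξ η }
  adj_rsmul := fun η a => inner_rsmul_right ξ η a
  inner_map_left := fun a η => by
    change inner A (ξ <• a) η = star a * inner A ξ η
    rw [← PreHilbertModule.star_inner η, inner_rsmul_right, star_mul, PreHilbertModule.star_inner]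

/-- The `M(A)`-valued inner product `⟨h, k⟩ = h⋆ ∘ k` of `M(E)`. -/
def innerM (h k : MultiplierModule A E) : MultiplierAlgebra A := h.adjoint.comp k

/-- For `h ∈ M(E)` and `ξ ∈ E`, the inner product `⟨h, ξ⟩_{M(E)}`, regarded as the element
`h⋆(ξ)` of `A`. -/
def pairing (h : MultiplierModule A E) (ξ : E) : A := h.adj ξ

/-- `⟨h, i_E(ξ)⟩_{M(E)}` is the image in `M(A)` of `pairing h ξ ∈ A`. -/
theorem innerM_ofModule (h : MultiplierModule A E) (ξ : E) :
    innerM h (ofModule A ξ) = ofModule A (pairing h ξ) :=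
  AdjointableMap.ext fun a => h.adj_rsmul ξ a

/-- `⟨i_E(ξ), h⟩_{M(E)}` is the image in `M(A)` of `star (pairing h ξ) ∈ A`. -/
theorem innerM_ofModule_left (h : MultiplierModule A E) (ξ : E) :
    innerM (ofModule A ξ) h = ofModule A (star (pairing h ξ)) :=
  AdjointableMap.ext fun a => by
    change inner A ξ (h a) = star (h.adj ξ) * a
    rw [← PreHilbertModule.star_inner (h a), h.inner_map_left]
    change star (star a * _) = _
    rw [star_mul, star_star]

/-- `h · a ∈ M(E)` is the image of `h(a) ∈ E`. -/
theorem rsmul_ofModule (h : MultiplierModule A E) (a : A) :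
    h <• (ofModule A a : MultiplierAlgebra A) = ofModule A (h a) :=
  AdjointableMap.ext fun b => h.map_rsmul a b

variable (A E) in
/-- `E` is countably generated in `M(E)`: there is a sequence `(g n)` in `M(E)` such that the
closed submodule of `M(E)` generated by the elements `g n · a`, `a ∈ A`, is (the image of) `E`. -/
def CountablyGenerated : Prop :=
  ∃ g : ℕ → MultiplierModule A E,
    ((sInf {N : Submodule (MultiplierAlgebra A)ᵐᵒᵖ (MultiplierModule A E) |
        IsClosed (N : Set (MultiplierModule A E)) ∧
          ∀ (n : ℕ) (a : A), g n <• (ofModule A a : MultiplierAlgebra A) ∈ N} :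
      Submodule (MultiplierAlgebra A)ᵐᵒᵖ (MultiplierModule A E)) : Set (MultiplierModule A E)) =
    Set.range (ofModule A : E → MultiplierModule A E)

/-- `(h n)` is a standard frame of multipliers in `E` with frame bounds `C` and `D`: for every `ξ`
the series `∑ ⟨ξ, h n⟩⟨h n, ξ⟩` converges in `A` and its sum lies between `C⟨ξ, ξ⟩` and
`D⟨ξ, ξ⟩`. -/
def IsStandardFrameWith (C D : ℝ) (h : ℕ → MultiplierModule A E) : Prop :=
  0 < C ∧ 0 < D ∧ ∀ ξ : E, ∃ s : A,
    Tendsto (fun N : ℕ => ∑ n ∈ Finset.range N, star (pairing (h n) ξ) * pairing (h n) ξ)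
      atTop (𝓝 s) ∧
    (C : ℂ) • inner A ξ ξ ≤ s ∧ s ≤ (D : ℂ) • inner A ξ ξ

/-- A standard normalised frame of multipliers: both frame bounds equal to `1`. -/
def IsStandardNormalisedFrame (h : ℕ → MultiplierModule A E) : Prop :=
  IsStandardFrameWith 1 1 h

end MultiplierModule

end Multipliers

/-! Put `S_N = ∑_{n<N} h_n h_n⋆`, so that `⟨ξ, S_N ξ⟩` is the partial sum of the frame series. The
claim is that `⟨ξ, S_N ξ⟩ → ⟨ξ, ξ⟩` for all `ξ` iff `S_N ξ → ξ` for all `ξ`. The second implies the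
first by Cauchy–Schwarz applied to `⟨ξ, S_N ξ - ξ⟩`.

Conversely, `⟨x, S_N x⟩` increases to `⟨x, x⟩`, so `T = 1 - S_N` satisfies `0 ≤ T ≤ 1`.
Cauchy–Schwarz for the positive form `⟨x, T y⟩` at `(Tξ, ξ)` then gives `p⟨Tξ, Tξ⟩ ≤ p⟨ξ, Tξ⟩`, and
the right side tends to `0` (`apply_inner_self_partialReconstruction_sub_le`).

Order arguments are made one C⋆-seminorm `p` at a time, in the C⋆-algebra obtained by completing `A`
for `p` (`Seminorm.exists_starHom_norm_eq`). `norm_map_form_sq_le` is stated for an abstract form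
because it serves both `⟨x, y⟩` and `⟨x, T y⟩`. -/

/-! ### Completion of a non-unital C⋆-seminormed algebra -/

namespace NonUnitalCompletion

open UniformSpace UniformSpace.Completion

variable {R : Type*} [NonUnitalSeminormedRing R]

/-- Multiplication on the completion of a non-unital seminormed ring. -/
noncomputable instance : Mul (Completion R) :=
  ⟨Function.curry <| (isDenseInducing_coe.prodMap isDenseInducing_coe).extend
    (((↑) : R → Completion R) ∘ Function.uncurry (· * ·))⟩

theorem coe_mul (a b : R) : ((a * b : R) : Completion R) = a * b :=
  ((isDenseInducing_coe.prodMap isDenseInducing_coe).extend_eq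
    ((continuous_coe R).comp (@continuous_mul R _ _ _)) (a, b)).symm

instance : ContinuousMul (Completion R) where
  continuous_mul := by
    let m := (AddMonoidHom.mul : R →+ R →+ R).compr₂ toCompl
    have : Continuous fun p : R × R => m p.1 p.2 := (continuous_coe R).comp continuous_mul
    have di : IsDenseInducing (toCompl : R → Completion R) := isDenseInducing_coe
    exact (di.extend_Z_bilin di this :)

noncomputable instance : NonUnitalNormedRing (Completion R) where
  __ : NormedAddCommGroup (Completion R) := inferInstance
  zero_mul a := Completion.induction_on a (isClosed_eq (by fun_prop) continuous_const)
    fun a => by rw [← coe_zero, ← coe_mul, zero_mul]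
  mul_zero a := Completion.induction_on a (isClosed_eq (by fun_prop) continuous_const)
    fun a => by rw [← coe_zero, ← coe_mul, mul_zero]
  mul_assoc a b c := Completion.induction_on₃ a b c (isClosed_eq (by fun_prop) (by fun_prop))
    fun a b c => by rw [← coe_mul, ← coe_mul, ← coe_mul, ← coe_mul, mul_assoc]
  left_distrib a b c := Completion.induction_on₃ a b c (isClosed_eq (by fun_prop) (by fun_prop))
    fun a b c => by rw [← coe_add, ← coe_mul, ← coe_mul, ← coe_mul, ← coe_add, mul_add]
  right_distrib a b c := Completion.induction_on₃ a b c (isClosed_eq (by fun_prop) (by fun_prop))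
    fun a b c => by rw [← coe_add, ← coe_mul, ← coe_mul, ← coe_mul, ← coe_add, add_mul]
  norm_mul_le x y := by
    induction x, y using Completion.induction_on₂ with
    | hp => apply isClosed_le <;> fun_prop
    | ih x y => simpa only [← coe_mul, norm_coe] using norm_mul_le x y

theorem smul_mul_assoc' [NormedSpace ℂ R] [IsScalarTower ℂ R R] (c : ℂ) (a b : Completion R) :
    c • a * b = c • (a * b) :=
  Completion.induction_on₂ a b
    (isClosed_eq ((continuous_fst.const_smul c).mul continuous_snd)
      ((continuous_fst.mul continuous_snd).const_smul c))
    fun a b => by rw [← coe_smul, ← coe_mul, ← coe_mul, ← coe_smul, smul_mul_assoc]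

theorem mul_smul_comm' [NormedSpace ℂ R] [SMulCommClass ℂ R R] (c : ℂ) (a b : Completion R) :
    a * c • b = c • (a * b) :=
  Completion.induction_on₂ a b
    (isClosed_eq (continuous_fst.mul (continuous_snd.const_smul c))
      ((continuous_fst.mul continuous_snd).const_smul c))
    fun a b => by rw [← coe_smul, ← coe_mul, ← coe_mul, ← coe_smul, mul_smul_comm]

variable [StarRing R] [NormedStarGroup R]

noncomputable instance : Star (Completion R) := ⟨Completion.map star⟩

/-- `Completion.map` extends a map faithfully only when it is uniformly continuous; for an additive
homomorphism continuity suffices. -/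
theorem uniformContinuous_star' : UniformContinuous (star : R → R) :=
  uniformContinuous_addMonoidHom_of_continuous (f := (starAddEquiv : R ≃+ R).toAddMonoidHom)
    continuous_star

theorem coe_star (a : R) : ((star a : R) : Completion R) = star (a : Completion R) :=
  (map_coe uniformContinuous_star' a).symm

instance : ContinuousStar (Completion R) := ⟨continuous_map⟩

noncomputable instance : StarRing (Completion R) where
  star_involutive a := Completion.induction_on a (isClosed_eq (by fun_prop) continuous_id)
    fun a => by rw [← coe_star, ← coe_star, star_star]
  star_mul a b := Completion.induction_on₂ a b (isClosed_eq (by fun_prop) (by fun_prop))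
    fun a b => by rw [← coe_star, ← coe_star, ← coe_mul, ← coe_mul, ← coe_star, star_mul]
  star_add a b := Completion.induction_on₂ a b (isClosed_eq (by fun_prop) (by fun_prop))
    fun a b => by rw [← coe_star, ← coe_star, ← coe_add, ← coe_add, ← coe_star, star_add]

theorem norm_mul_self_le (hR : ∀ a : R, ‖a‖ * ‖a‖ ≤ ‖star a * a‖) (a : Completion R) :
    ‖a‖ * ‖a‖ ≤ ‖star a * a‖ :=
  Completion.induction_on a
    (isClosed_le (continuous_norm.mul continuous_norm) (continuous_id.star.mul continuous_id).norm)
    fun a => by simpa only [← coe_star, ← coe_mul, norm_coe] using hR a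

theorem star_smul' [NormedSpace ℂ R] [StarModule ℂ R] (c : ℂ) (a : Completion R) :
    star (c • a) = star c • star a :=
  Completion.induction_on a
    (isClosed_eq (continuous_id.const_smul c).star (continuous_id.star.const_smul (star c)))
    fun a => by rw [← coe_smul, ← coe_star, ← coe_star, ← coe_smul, star_smul]

/-- The completion of a non-unital `*`-algebra with a C⋆-seminorm is a C⋆-algebra. -/
@[reducible] noncomputable def nonUnitalCStarAlgebra [NormedSpace ℂ R]
    [IsScalarTower ℂ R R] [SMulCommClass ℂ R R] [StarModule ℂ R]
    (hR : ∀ a : R, ‖a‖ * ‖a‖ ≤ ‖star a * a‖) : NonUnitalCStarAlgebra (Completion R) where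
  __ : NormedSpace ℂ (Completion R) := inferInstance
  norm_mul_self_le := norm_mul_self_le hR
  smul_assoc := smul_mul_assoc'
  smul_comm c a b := (mul_smul_comm' c a b).symm
  star_smul := star_smul'

end NonUnitalCompletion

/-! ### Representing a C⋆-seminorm in a C⋆-algebra -/

/-- Every C⋆-seminorm on a `*`-algebra is induced by a `*`-homomorphism into a C⋆-algebra. -/
theorem Seminorm.exists_starHom_norm_eq.{u} {A : Type u} [NonUnitalRing A] [StarRing A] [Module ℂ A]
    [IsScalarTower ℂ A A] [SMulCommClass ℂ A A] [StarModule ℂ A] (p : Seminorm ℂ A)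
    (hmul : ∀ a b : A, p (a * b) ≤ p a * p b) (hstar : ∀ a : A, p (star a * a) = p a ^ 2) :
    ∃ (B : Type u) (_ : NonUnitalCStarAlgebra B) (_ : PartialOrder B) (_ : StarOrderedRing B)
      (π : A →⋆ₙₐ[ℂ] B), ∀ a, ‖π a‖ = p a := by
  -- Isometry of the involution follows from the C⋆-identity: `p(a)² = p(a⋆a) ≤ p(a⋆) p(a)`, then
  -- cancel `p(a)`.
  have hle : ∀ a, p a ≤ p (star a) := fun a => by
    rcases (apply_nonneg p a).eq_or_lt with h | h
    · rw [← h]; exact apply_nonneg p _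
    · have := hmul (star a) a
      rw [hstar, sq] at this
      exact le_of_mul_le_mul_right this h
  let _ : SeminormedAddCommGroup A := p.toAddGroupSeminorm.toSeminormedAddCommGroup
  let _ : NonUnitalSeminormedRing A :=
    { ‹NonUnitalRing A›, ‹SeminormedAddCommGroup A› with norm_mul_le := hmul }
  let _ : NormedSpace ℂ A :=
    { ‹Module ℂ A› with norm_smul_le := fun c a => (map_smul_eq_mul p c a).le }
  have : NormedStarGroup A := ⟨fun a => (hle (star a)).trans_eq (by rw [star_star]; rfl)⟩
  -- The completion is Hausdorff, so the kernel of `p` is divided out without forming a quotient.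
  let C := NonUnitalCompletion.nonUnitalCStarAlgebra (R := A)
    fun a => (hstar a |>.trans (sq _)).ge
  refine ⟨UniformSpace.Completion A, C, CStarAlgebra.spectralOrder _,
    CStarAlgebra.spectralOrderedRing _,
    { toFun := (↑)
      map_smul' := UniformSpace.Completion.coe_smul
      map_mul' := NonUnitalCompletion.coe_mul
      map_zero' := UniformSpace.Completion.coe_zero
      map_add' := UniformSpace.Completion.coe_add
      map_star' := NonUnitalCompletion.coe_star }, UniformSpace.Completion.norm_coe⟩

/-! ### Cauchy–Schwarz for algebra-valued forms -/

/-- The optimisation in Cauchy–Schwarz, with `v` in the role of `‖f x y‖²`: the best choice is `t =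
1 / Y`, and if `Y = 0` a large `t` forces `v ≤ 0`. -/
theorem le_mul_of_forall_two_mul_le {v X Y : ℝ} (hX : 0 ≤ X) (hY : 0 ≤ Y)
    (h : ∀ t : ℝ, 0 ≤ t → 2 * t * v ≤ X + t ^ 2 * (v * Y)) : v ≤ X * Y := by
  rcases hY.eq_or_lt with rfl | hY
  · by_contra! hv
    rw [mul_zero] at hv
    have := h ((X + 1) / v) (by positivity)
    rw [mul_assoc, div_mul_cancel₀ _ hv.ne'] at this
    linarith
  · have := h Y⁻¹ (by positivity)
    have h1 : Y⁻¹ ^ 2 * (v * Y) = Y⁻¹ * v := by field_simp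
    rw [h1] at this
    rw [← div_le_iff₀ hY, div_eq_inv_mul]
    linarith

/-- Cauchy–Schwarz inequality for a sesquilinear form on a right `A`-module with values in `A`,
positive after applying a `*`-homomorphism `π` into a C⋆-algebra. -/
theorem norm_map_form_sq_le {A B E : Type*} [NonUnitalRing A] [StarRing A] [Module ℂ A]
    [NonUnitalCStarAlgebra B] [PartialOrder B] [StarOrderedRing B] [AddCommGroup E] [Module ℂ E]
    [SMul Aᵐᵒᵖ E] (π : A →⋆ₙₐ[ℂ] B) (f : E → E → A)
    (f_add : ∀ x y z, f x (y + z) = f x y + f x z) (f_smul : ∀ (c : ℂ) x y, f x (c • y) = c • f x y)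
    (f_rsmul : ∀ x y (a : A), f x (y <• a) = f x y * a) (star_f : ∀ x y, star (f x y) = f y x)
    (f_nonneg : ∀ x, 0 ≤ π (f x x)) (x y : E) :
    ‖π (f x y)‖ ^ 2 ≤ ‖π (f x x)‖ * ‖π (f y y)‖ := by
  set b := π (f y x) with hb
  set X := π (f x x) with hX
  set Y := π (f y y) with hY
  have hxy : π (f x y) = star b := by rw [← star_f y x, map_star]
  have hsX : star X = X := (IsSelfAdjoint.of_nonneg (f_nonneg x)).star_eq
  have hsY : star Y = Y := (IsSelfAdjoint.of_nonneg (f_nonneg y)).star_eq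
  rw [hxy, norm_star]
  refine le_mul_of_forall_two_mul_le (norm_nonneg _) (norm_nonneg _) fun t ht => ?_
  set c : ℂ := -(t : ℂ) with hc
  have hsc : star c = c := by simp [hc]
  -- Expand the form at `x - t · y⟨y, x⟩`; its positivity is the operator inequality `2t b⋆b ≤ X +
  -- t² b⋆Yb`.
  have key : π (f (x + c • (y <• f y x)) (x + c • (y <• f y x))) =
      (X + (t : ℂ) ^ 2 • (star b * Y * b)) -
        ((t : ℂ) • (star b * b) + (t : ℂ) • (star b * b)) := by
    have h1 : ∀ w, f w (x + c • (y <• f y x)) = f w x + c • (f w y * f y x) := fun w => by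
      rw [f_add, f_smul, f_rsmul]
    have h2 : ∀ w, f (x + c • (y <• f y x)) w = star (f w x + c • (f w y * f y x)) := fun w => by
      rw [← h1, star_f]
    rw [h1, h2, h2]
    simp only [map_add, map_smul, map_mul, map_star, ← hb, ← hX, ← hY, hxy, star_add, star_smul,
      star_mul, hsX, hsY, hsc, star_star, add_mul, smul_mul_assoc, smul_add, smul_smul, mul_assoc]
    rw [hc, neg_mul_neg, ← sq, neg_smul]
    abel
  have hle : (t : ℂ) • (star b * b) + (t : ℂ) • (star b * b) ≤
      X + (t : ℂ) ^ 2 • (star b * Y * b) := by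
    rw [← sub_nonneg, ← key]; exact f_nonneg _
  have hnn : 0 ≤ (t : ℂ) • (star b * b) := by
    have : (t : ℂ) • (star b * b) = star (((√t : ℝ) : ℂ) • b) * (((√t : ℝ) : ℂ) • b) := by
      rw [star_smul, smul_mul_smul_comm, Complex.star_def, Complex.conj_ofReal,
        ← Complex.ofReal_mul, Real.mul_self_sqrt ht]
    rw [this]; exact star_mul_self_nonneg _
  -- The norm is monotone on positive elements, and by the C⋆-identity the smaller side has norm
  -- exactly `2t‖b‖²`.
  have hnorm := CStarAlgebra.norm_le_norm_of_nonneg_of_le (add_nonneg hnn hnn) hle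
  have hleft : ‖(t : ℂ) • (star b * b) + (t : ℂ) • (star b * b)‖ = 2 * t * ‖b‖ ^ 2 := by
    rw [← two_smul ℂ, smul_smul, norm_smul, CStarRing.norm_star_mul_self, norm_mul,
      Complex.norm_real, Real.norm_of_nonneg ht, RCLike.norm_ofNat, sq]
  rw [hleft] at hnorm
  refine hnorm.trans ((norm_add_le _ _).trans (add_le_add_right ?_ _))
  rw [norm_smul, norm_pow, Complex.norm_real, Real.norm_of_nonneg ht]
  gcongr
  calc ‖star b * Y * b‖ ≤ ‖star b‖ * ‖Y‖ * ‖b‖ :=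
        (norm_mul_le _ _).trans (by gcongr; exact norm_mul_le _ _)
    _ = ‖b‖ ^ 2 * ‖Y‖ := by rw [norm_star]; ring

/-! ### Convergence in terms of seminorms -/

/-- Translation invariance reduces everything to `0`. No triangle inequality is asked of `q i`, so
`moduleSeminorm p` qualifies directly. -/
theorem tendsto_nhds_iff_of_basis_zero {G ι α : Type*} [AddCommGroup G] [TopologicalSpace G]
    [IsTopologicalAddGroup G] {S : Set ι} {q : ι → G → ℝ} (hq : ∀ i x, 0 ≤ q i x)
    (hG : ∀ U : Set G, U ∈ 𝓝 (0 : G) ↔ ∃ i ∈ S, ∃ ε : ℝ, 0 < ε ∧ {x | q i x < ε} ⊆ U)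
    {l : Filter α} {u : α → G} {a : G} :
    Tendsto u l (𝓝 a) ↔ ∀ i ∈ S, Tendsto (fun n => q i (u n - a)) l (𝓝 0) := by
  rw [← tendsto_sub_nhds_zero_iff]
  constructor
  · intro h i hi
    refine (tendsto_order.2 ⟨fun r hr => .of_forall fun n => hr.trans_le (hq _ _), fun r hr => ?_⟩)
    exact h ((hG {x | q i x < r}).2 ⟨i, hi, r, hr, subset_rfl⟩)
  · intro h U hU
    obtain ⟨i, hi, ε, hε, hs⟩ := (hG U).1 hU
    exact ((h i hi).eventually_lt_const hε).mono fun n hn => hs hn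

section

open PreHilbertModule

variable {A E : Type*} [NonUnitalRing A] [StarRing A] [Module ℂ A]

theorem ProCStarAlgebra.tendsto_nhds_iff [IsScalarTower ℂ A A] [SMulCommClass ℂ A A]
    [StarModule ℂ A] [UniformSpace A] [IsUniformAddGroup A] [ProCStarAlgebra A]
    {α : Type*} {l : Filter α} {u : α → A} {a : A} :
    Tendsto u l (𝓝 a) ↔
      ∀ p ∈ contCStarSeminorms A, Tendsto (fun n => p (u n - a)) l (𝓝 0) :=
  tendsto_nhds_iff_of_basis_zero (q := fun (p : Seminorm ℂ A) a => p a)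
    (fun p a => apply_nonneg p a) ProCStarAlgebra.mem_nhds_zero_iff

variable [PartialOrder A] [AddCommGroup E] [Module ℂ E] [SMul Aᵐᵒᵖ E] [PreHilbertModule A E]

theorem HilbertModule.tendsto_nhds_iff [TopologicalSpace A] [UniformSpace E] [IsUniformAddGroup E]
    [HilbertModule A E] {α : Type*} {l : Filter α} {u : α → E} {x : E} :
    Tendsto u l (𝓝 x) ↔
      ∀ p ∈ contCStarSeminorms A, Tendsto (fun n => moduleSeminorm p (u n - x)) l (𝓝 0) :=
  tendsto_nhds_iff_of_basis_zero (q := fun (p : Seminorm ℂ A) (x : E) => moduleSeminorm p x)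
    (fun _ _ => Real.sqrt_nonneg _) HilbertModule.mem_nhds_zero_iff

theorem PreHilbertModule.inner_sum_right {ι : Type*} (s : Finset ι) (x : E) (y : ι → E) :
    inner A x (∑ i ∈ s, y i) = ∑ i ∈ s, inner A x (y i) :=
  map_sum (AddMonoidHom.mk' (fun y => inner A x y) (inner_add_right x)) y s

variable [IsScalarTower ℂ A A] [SMulCommClass ℂ A A] [StarModule ℂ A] [StarOrderedRing A]

/-- Cauchy–Schwarz inequality in a pre-Hilbert module. -/
theorem contCStarSeminorms.apply_inner_le [TopologicalSpace A] {p : Seminorm ℂ A}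
    (hp : p ∈ contCStarSeminorms A) (x y : E) :
    p (inner A x y) ≤ moduleSeminorm p x * moduleSeminorm p y := by
  obtain ⟨B, _, _, _, π, hπ⟩ := p.exists_starHom_norm_eq hp.2.1 hp.2.2
  have := norm_map_form_sq_le π (fun x y : E => inner A x y) inner_add_right inner_smul_right
    inner_rsmul_right star_inner
    (fun x => by simpa using OrderHomClass.mono π (inner_self_nonneg (A := A) x)) x y
  simp only [hπ] at this
  rw [moduleSeminorm, moduleSeminorm, ← Real.sqrt_mul (apply_nonneg _ _)]
  exact Real.le_sqrt_of_sq_le this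

variable [UniformSpace A] [IsUniformAddGroup A] [ProCStarAlgebra A]

/-! ### Partial sums of the reconstruction series -/

namespace MultiplierModule

theorem inner_apply_pairing (h : MultiplierModule A E) (x y : E) :
    inner A x (h (pairing h y)) = star (pairing h x) * pairing h y := by
  rw [← star_inner (h (pairing h y)), h.inner_map_left]
  change star (star (pairing h y) * pairing h x) = _
  rw [star_mul, star_star]

/-- The partial sum `∑_{n < N} h n · ⟨h n, ξ⟩` of the reconstruction series. -/
def partialReconstruction (h : ℕ → MultiplierModule A E) (N : ℕ) (ξ : E) : E :=
  ∑ n ∈ Finset.range N, h n (pairing (h n) ξ)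

/-- In this form the symmetry and positivity of `S_N`, and its growth with `N`, are visible. -/
theorem inner_partialReconstruction (h : ℕ → MultiplierModule A E) (N : ℕ) (x y : E) :
    inner A x (partialReconstruction h N y) =
      ∑ n ∈ Finset.range N, star (pairing (h n) x) * pairing (h n) y := by
  simp only [partialReconstruction, PreHilbertModule.inner_sum_right, inner_apply_pairing]

/-- With both bounds equal to `1`, antisymmetry of the order pins the sum to `⟨ξ, ξ⟩`. -/
theorem isStandardNormalisedFrame_iff (h : ℕ → MultiplierModule A E) :
    IsStandardNormalisedFrame h ↔ ∀ ξ : E, Tendsto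
      (fun N => inner A ξ (partialReconstruction h N ξ)) atTop (𝓝 (inner A ξ ξ)) := by
  simp only [inner_partialReconstruction]
  constructor
  · rintro ⟨-, -, H⟩ ξ
    obtain ⟨s, hs, h1, h2⟩ := H ξ
    rw [Complex.ofReal_one, one_smul] at h1 h2
    rwa [le_antisymm h1 h2]
  · exact fun H => ⟨one_pos, one_pos, fun ξ => ⟨_, H ξ, by simp, by simp⟩⟩

/-- If `∑ ⟨ξ, h n⟩⟨h n, ξ⟩` converges to `⟨ξ, ξ⟩` for all `ξ`, then
`I - ∑_{n < N} h n ∘ (h n)⋆` is a positive contraction, whence this estimate. -/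
theorem apply_inner_self_partialReconstruction_sub_le (h : ℕ → MultiplierModule A E)
    (H : ∀ ξ : E, Tendsto
      (fun N => inner A ξ (partialReconstruction h N ξ)) atTop (𝓝 (inner A ξ ξ)))
    {p : Seminorm ℂ A} (hp : p ∈ contCStarSeminorms A) (N : ℕ) (ξ : E) :
    p (inner A (partialReconstruction h N ξ - ξ) (partialReconstruction h N ξ - ξ)) ≤
      p (inner A ξ (partialReconstruction h N ξ) - inner A ξ ξ) := by
  obtain ⟨B, _, _, _, π, hπ⟩ := p.exists_starHom_norm_eq hp.2.1 hp.2.2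
  -- Monotonicity is transported to `B`, where the positive cone is closed and an increasing
  -- convergent sequence stays below its limit.
  have hmono (x : E) : Monotone fun N => π (inner A x (partialReconstruction h N x)) :=
    monotone_nat_of_le_succ fun N => OrderHomClass.mono π <| by
      rw [inner_partialReconstruction, inner_partialReconstruction, Finset.sum_range_succ]
      exact le_add_of_nonneg_right (star_mul_self_nonneg _)
  have htend (x : E) : Tendsto (fun N => π (inner A x (partialReconstruction h N x))) atTop
      (𝓝 (π (inner A x x))) := by
    rw [tendsto_iff_norm_sub_tendsto_zero]
    simpa only [← map_sub, hπ] using ProCStarAlgebra.tendsto_nhds_iff.1 (H x) p hp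
  have hnonneg (x : E) : 0 ≤ π (inner A x (partialReconstruction h N x)) := by
    simpa [partialReconstruction, PreHilbertModule.inner_zero_right] using hmono x (Nat.zero_le N)
  -- The form `⟨x, T y⟩` with `T = 1 - S_N`; `hf` and `hf_le` express `0 ≤ T` and the norm
  -- consequence of `T ≤ 1`.
  let f : E → E → A := fun x y => inner A x y - inner A x (partialReconstruction h N y)
  have hf (x : E) : 0 ≤ π (f x x) := by
    rw [map_sub, sub_nonneg]
    exact (hmono x).ge_of_tendsto (htend x) N
  have hf_le (x : E) : ‖π (f x x)‖ ≤ ‖π (inner A x x)‖ :=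
    CStarAlgebra.norm_le_norm_of_nonneg_of_le (hf x) <| by
      rw [map_sub]; exact sub_le_self _ (hnonneg x)
  set r := partialReconstruction h N ξ - ξ with hr
  have hcs := norm_map_form_sq_le π f
    (fun x y z => by
      simp only [f, inner_partialReconstruction, PreHilbertModule.inner_add_right, pairing, map_add,
        mul_add, Finset.sum_add_distrib]
      abel)
    (fun c x y => by
      simp only [f, inner_partialReconstruction, PreHilbertModule.inner_smul_right, pairing, map_smul,
        mul_smul_comm, ← Finset.smul_sum, smul_sub])
    (fun x y a => by
      simp only [f, inner_partialReconstruction, inner_rsmul_right, pairing,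
        AdjointableMap.adj_rsmul, sub_mul, Finset.sum_mul]
      simp only [mul_assoc]
      rfl)
    (fun x y => by
      simp only [f, inner_partialReconstruction, star_sub, star_inner, star_sum, star_mul,
        star_star])
    hf r ξ
  -- Since `r = -Tξ`, one has `f r ξ = ⟨r, Tξ⟩ = -⟨r, r⟩`.
  have hrr : ‖π (f r ξ)‖ = p (inner A r r) := by
    rw [hπ, ← map_neg_eq_map]
    simp only [f]
    rw [neg_sub, ← inner_sub_right', ← hr]
  have hξξ : ‖π (f ξ ξ)‖ = p (inner A ξ (partialReconstruction h N ξ) - inner A ξ ξ) := by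
    rw [hπ, map_sub_rev]
  -- This reads `p⟨r, r⟩² ≤ p⟨r, r⟩ · p⟨ξ, Tξ⟩`; cancelling one factor gives the claim.
  have h3 := hcs.trans (mul_le_mul_of_nonneg_right (hf_le r) (norm_nonneg _))
  rw [hrr, hξξ, hπ, sq] at h3
  rcases (apply_nonneg p (inner A r r)).eq_or_lt with h0 | h0
  · rw [← h0]; exact apply_nonneg _ _
  · exact le_of_mul_le_mul_left h3 h0

end MultiplierModule

end

/-! ### The equivalence -/

theorem theorem3p7 {A E : Type*}
    [NonUnitalRing A] [StarRing A] [Module ℂ A]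
    [IsScalarTower ℂ A A] [SMulCommClass ℂ A A] [StarModule ℂ A]
    [PartialOrder A] [StarOrderedRing A]
    [UniformSpace A] [IsUniformAddGroup A] [ProCStarAlgebra A]
    [AddCommGroup E] [Module ℂ E] [SMul Aᵐᵒᵖ E] [PreHilbertModule A E]
    [UniformSpace E] [IsUniformAddGroup E] [HilbertModule A E]
    (hE : MultiplierModule.CountablyGenerated A E)
    (h : ℕ → MultiplierModule A E) :
    MultiplierModule.IsStandardNormalisedFrame h ↔
      ∀ ξ : E, Tendsto
        (fun N : ℕ => ∑ n ∈ Finset.range N, h n (MultiplierModule.pairing (h n) ξ))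
        atTop (𝓝 ξ) := by
  rw [MultiplierModule.isStandardNormalisedFrame_iff]
  change _ ↔ ∀ ξ : E, Tendsto
    (fun N => MultiplierModule.partialReconstruction h N ξ) atTop (𝓝 ξ)
  constructor
  · refine fun H ξ => (HilbertModule.tendsto_nhds_iff (A := A)).2 fun p hp => ?_
    have h0 := (ProCStarAlgebra.tendsto_nhds_iff.1 (H ξ) p hp).sqrt
    rw [Real.sqrt_zero] at h0
    exact squeeze_zero (fun _ => Real.sqrt_nonneg _) (fun N => Real.sqrt_le_sqrt
      (MultiplierModule.apply_inner_self_partialReconstruction_sub_le h H hp N ξ)) h0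
  · refine fun H ξ => ProCStarAlgebra.tendsto_nhds_iff.2 fun p hp => ?_
    -- Cauchy–Schwarz bounds `p⟨ξ, S_N ξ - ξ⟩` by the error seminorm times a factor independent of
    -- `N`.
    have h0 := ((HilbertModule.tendsto_nhds_iff (A := A)).1 (H ξ) p hp).const_mul
      (moduleSeminorm p ξ)
    rw [mul_zero] at h0
    refine squeeze_zero (fun _ => apply_nonneg _ _) (fun N => ?_) h0
    rw [← PreHilbertModule.inner_sub_right']
    exact contCStarSeminorms.apply_inner_le hp _ _
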